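/- Let $d \ge 1$, let $1 \le p < \infty$ and $\frac1p + \frac1{p'} = 1$ (so $p' = \infty$ if $p = 1$), and let $f \in L^p(\mathbb{R}^d)$ and $\psi \in L^{p'}(\mathbb{R}^d)$ be complex-valued. For $s > 0$ and $t \in \mathbb{R}^d$ put $\psi_{s,t}(x) = s^{-d/2}\, \psi\big(\frac{x-t}{s}\big)$ and $\langle f, \psi_{s,t} \rangle = \int_{\mathbb{R}^d} f(x)\, \overline{\psi_{s,t}(x)}\, dx$. Let $\widehat{\psi}$ denote the distributional Fourier transform of $\psi$ (with kernel $e^{-2\pi i \omega\cdot x}$). Assume that $\widehat{\psi}$ is smooth on $\mathbb{R}^d \setminus \{0\}$, in the sense that there is a function $\nu \in C^\infty(\mathbb{R}^d \setminus \{0\})$ with $\widehat{\psi}[\eta] = \int_{\mathbb{R}^d} \nu(\omega)\, \eta(\omega)\, d\omega$ for all $\eta \in C_c^\infty(\mathbb{R}^d \setminus \{0\})$, and that $\widehat\psi$ is nontrivial in every direction, in the sense that for every unit vector $\xi \in \mathbb{R}^d$ the set $\{ r > 0 : \nu(r\xi) \neq 0 \}$ has positive Lebesgue measure. If $$\langle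 f, \psi_{s,t} \rangle = 0 \qquad \text{for all } s > 0,\ t \in \mathbb{R}^d,$$ then $f = 0$ almost everywhere. -/

import Mathlib

open MeasureTheory
open scoped ENNReal ContDiff SchwartzMap FourierTransform ComplexConjugate

noncomputable section

/-- The rescaled and translated wavelet `ψ_{s,t}(x) = s^{-d/2} ψ((x - t) / s)` on `ℝ^d`. -/
def dilatedWavelet {d : ℕ} (ψ : EuclideanSpace ℝ (Fin d) → ℂ) (s : ℝ)
    (t x : EuclideanSpace ℝ (Fin d)) : ℂ :=
  ((1 / s ^ ((d : ℝ) / 2) : ℝ) : ℂ) * ψ (s⁻¹ • (x - t))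

/-- The continuous wavelet transform `(W_ψ f)(s,t) = ∫ f(x) conj(ψ_{s,t}(x)) dx`. -/
def waveletTransform {d : ℕ} (ψ f : EuclideanSpace ℝ (Fin d) → ℂ) (s : ℝ)
    (t : EuclideanSpace ℝ (Fin d)) : ℂ :=
  ∫ x, f x * conj (dilatedWavelet ψ s t x)

/-- The function `g` is nontrivial in the direction `ξ`: the set of `r > 0` with `g (r ξ) ≠ 0`
has positive Lebesgue measure. -/
def NontrivialInDirection {d : ℕ} (g : EuclideanSpace ℝ (Fin d) → ℂ)
    (ξ : EuclideanSpace ℝ (Fin d)) : Prop :=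
  0 < volume {r : ℝ | 0 < r ∧ g (r • ξ) ≠ 0}

/-- The function `ν` represents the tempered distribution `T` on `ℝ^d ∖ {0}`:
`T[η] = ∫ ν(y) η(y) dy` for every test function `η ∈ C_c^∞(ℝ^d ∖ {0})`.
(A compactly supported Schwartz function is the same thing as a compactly supported smooth
function.) -/
def RepresentsOffOrigin {d : ℕ} (T : 𝓢'(EuclideanSpace ℝ (Fin d), ℂ))
    (ν : EuclideanSpace ℝ (Fin d) → ℂ) : Prop :=
  ∀ η : 𝓢(EuclideanSpace ℝ (Fin d), ℂ), HasCompactSupport η →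
    tsupport η ⊆ ({0}ᶜ : Set (EuclideanSpace ℝ (Fin d))) → T η = ∫ y, ν y * η y

end

/-! At a fixed scale `s`, vanishing of the wavelet transform says that `f` convolved with a
reflected conjugate dilate of `ψ` is zero. Pairing this with `𝓕 g`, for `g` a test function off the
origin, gives `∫ f * 𝓕 m = 0` with `m = conj (ν (s •)) * g`
(`integral_mul_fourier_eq_zero_of_waveletTransform`). As `ν` vanishes on no ray, compactness writes
every test function off the origin as a finite sum of such `m`
(`exists_finset_sum_conj_dilate_mul`). So the Fourier transform of `f` is supported at the origin.

An `L^p` function with `p < ∞` and this property is zero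
(`ae_eq_zero_of_fourier_vanishes_off_origin`). No structure theorem for distributions supported at a
point is needed: with `χ = 1` near `0`, the pairing of `f` with `𝓕 (χ (r •) * φ)` does not depend on
`r > 0`; it tends to `∫ f * 𝓕 φ` as `r → 0` and to `0` as `r → ∞`. -/

section Hoelder

variable {α : Type*} [MeasurableSpace α] {μ : Measure α} {p q : ℝ≥0∞}

lemma integral_norm_mul_le_eLpNorm_mul_eLpNorm [p.HolderConjugate q] {f g : α → ℂ}
    (hf : MemLp f p μ) (hg : MemLp g q μ) :
    ∫ x, ‖f x * g x‖ ∂μ ≤ (eLpNorm f p μ).toReal * (eLpNorm g q μ).toReal := by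
  have h : eLpNorm (f • g) 1 μ ≤ eLpNorm f p μ * eLpNorm g q μ :=
    eLpNorm_smul_le_mul_eLpNorm hg.1 hf.1
  have hi : Integrable (f * g) μ := hf.integrable_mul hg
  rw [← ENNReal.toReal_mul]
  refine le_trans (le_of_eq ?_)
    (ENNReal.toReal_mono (ENNReal.mul_ne_top hf.eLpNorm_ne_top hg.eLpNorm_ne_top) h)
  rw [eLpNorm_one_eq_lintegral_enorm, ← integral_norm_eq_lintegral_enorm (show AEStronglyMeasurable (f • g) μ from hi.1)]
  rfl

lemma norm_integral_mul_le_eLpNorm_mul_eLpNorm [p.HolderConjugate q] {f g : α → ℂ}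
    (hf : MemLp f p μ) (hg : MemLp g q μ) :
    ‖∫ x, f x * g x ∂μ‖ ≤ (eLpNorm f p μ).toReal * (eLpNorm g q μ).toReal :=
  (norm_integral_le_integral_norm _).trans (integral_norm_mul_le_eLpNorm_mul_eLpNorm hf hg)

end Hoelder

/-! ### Fourier transforms supported at the origin. -/

section Convolution

open Filter Topology

variable {V : Type*} [NormedAddCommGroup V] [InnerProductSpace ℝ V] [FiniteDimensional ℝ V]
  [MeasurableSpace V] [BorelSpace V] {p q : ℝ≥0∞}

lemma memLp_comp_sub {k : V → ℂ} (hk : MemLp k q) (a : V) : MemLp (fun x => k (x - a)) q :=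
  hk.comp_measurePreserving (measurePreserving_sub_right volume a)

lemma eLpNorm_comp_sub {k : V → ℂ} (hk : MemLp k q) (a : V) :
    eLpNorm (fun x => k (x - a)) q = eLpNorm k q :=
  eLpNorm_comp_measurePreserving hk.1 (measurePreserving_sub_right volume a)

lemma memLp_comp_smul {k : V → ℂ} (hk : MemLp k q) {r : ℝ} (hr : r ≠ 0) :
    MemLp (fun x => k (r • x)) q := by
  refine MemLp.comp_of_map (f := fun x : V => r • x) (g := k) ?_ (by fun_prop)
  rw [Measure.map_addHaar_smul volume hr]
  exact hk.smul_measure ENNReal.ofReal_ne_top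

/-- The joint integrability behind all uses of Fubini's theorem for the convolution of
an `L^p`, an `L^q` and an integrable function. -/
lemma integrable_prod_mul_comp_sub_smul [p.HolderConjugate q] {f k h : V → ℂ}
    (hf : MemLp f p) (hk : MemLp k q) (hh : Integrable h) (c : ℝ) :
    Integrable (fun z : V × V => f z.1 * k (z.1 - c • z.2) * h z.2) (volume.prod volume) := by
  have hq : Measure.QuasiMeasurePreserving (fun z : V × V => z.1 - c • z.2)
      (volume.prod volume) volume :=
    MeasureTheory.QuasiMeasurePreserving.prod_of_left (by fun_prop) (.of_forall fun y =>
      (measurePreserving_sub_right volume (c • y)).quasiMeasurePreserving)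
  have hm : AEStronglyMeasurable (fun z : V × V => f z.1 * k (z.1 - c • z.2) * h z.2)
      (volume.prod volume) :=
    (hf.1.comp_fst.mul (hk.1.comp_quasiMeasurePreserving hq)).mul hh.1.comp_snd
  -- Integrating in the first variable first, Hölder gives a bound independent of the translation.
  rw [integrable_prod_iff' hm]
  refine ⟨.of_forall fun y => ?_, ?_⟩
  · exact (hf.integrable_mul (memLp_comp_sub hk (c • y))).mul_const (h y)
  · refine Integrable.mono' (hh.norm.const_mul ((eLpNorm f p).toReal * (eLpNorm k q).toReal))
      hm.norm.prod_swap.integral_prod_right' (.of_forall fun y => ?_)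
    rw [Real.norm_of_nonneg (by positivity)]
    simp_rw [norm_mul _ (h y)]
    rw [integral_mul_const, ← eLpNorm_comp_sub hk (c • y)]
    gcongr
    exact integral_norm_mul_le_eLpNorm_mul_eLpNorm hf (memLp_comp_sub hk (c • y))

/-- Pointwise convergence of translates of a Schwartz function implies convergence of the pairings
with an `L^p` function. -/
lemma tendsto_integral_mul_comp_sub [p.HolderConjugate q] (hp : p ≠ ⊤) {f : V → ℂ}
    (hf : MemLp f p) (h c : 𝓢(V, ℂ)) {ι : Type*} {l : Filter ι} [l.IsCountablyGenerated]
    {y : ι → V} (hc : ∀ x, Tendsto (fun i => h (x - y i)) l (𝓝 (c x))) :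
    Tendsto (fun i => ∫ x, f x * h (x - y i)) l (𝓝 (∫ x, f x * c x)) := by
  have hh : MemLp h q := h.memLp q
  have hcq : MemLp c q := c.memLp q
  rw [Metric.tendsto_nhds]
  intro ε hε
  -- The two Hölder errors from approximating `f` total at most `ε / 3`; the `+ 1` keeps `A`
  -- positive.
  set A := (eLpNorm h q).toReal + (eLpNorm c q).toReal + 1 with hA
  have hA0 : 0 < A := by positivity
  obtain ⟨g, hgc, hfg, hg, hgp⟩ := hf.exists_hasCompactSupport_eLpNorm_sub_le hp
    (ε := ENNReal.ofReal (ε / 3 / A)) (by simpa using by positivity)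
  have hfg' : (eLpNorm (f - g) p).toReal ≤ ε / 3 / A :=
    ENNReal.toReal_le_of_le_ofReal (by positivity) hfg
  have hgi : Integrable g := hg.integrable_of_hasCompactSupport hgc
  have hlim : Tendsto (fun i => ∫ x, g x * h (x - y i)) l (𝓝 (∫ x, g x * c x)) := by
    refine tendsto_integral_filter_of_dominated_convergence
      (fun x => ‖g x‖ * (SchwartzMap.seminorm ℝ 0 0) h)
      (.of_forall fun i => ?_) (.of_forall fun i => .of_forall fun x => ?_)
      (hgi.norm.mul_const _) (.of_forall fun x => (hc x).const_mul _)
    · exact (by fun_prop : Continuous fun x => g x * h (x - y i)).aestronglyMeasurable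
    · rw [norm_mul]
      gcongr
      exact h.norm_le_seminorm ℝ _
  filter_upwards [Metric.tendsto_nhds.1 hlim (ε / 3) (by positivity)] with i hi
  rw [dist_eq_norm] at hi ⊢
  have hhi := memLp_comp_sub hh (y i)
  have hd := hf.sub hgp
  have b1 := norm_integral_mul_le_eLpNorm_mul_eLpNorm hd hhi
  have b2 := norm_integral_mul_le_eLpNorm_mul_eLpNorm hd hcq
  rw [eLpNorm_comp_sub hh] at b1
  have e1 : ∫ x, (f - g) x * h (x - y i) = (∫ x, f x * h (x - y i)) - ∫ x, g x * h (x - y i) := by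
    simp_rw [Pi.sub_apply, sub_mul]
    exact integral_sub (hf.integrable_mul hhi) (hgp.integrable_mul hhi)
  have e2 : ∫ x, (f - g) x * c x = (∫ x, f x * c x) - ∫ x, g x * c x := by
    simp_rw [Pi.sub_apply, sub_mul]
    exact integral_sub (hf.integrable_mul hcq) (hgp.integrable_mul hcq)
  have hb : (eLpNorm (f - g) p).toReal * (eLpNorm h q).toReal
      + (eLpNorm (f - g) p).toReal * (eLpNorm c q).toReal ≤ ε / 3 := by
    calc _ = (eLpNorm (f - g) p).toReal * ((eLpNorm h q).toReal + (eLpNorm c q).toReal) := by ring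
      _ ≤ ε / 3 / A * A := by
        gcongr
        linarith
      _ = ε / 3 := by field_simp
  calc _ = ‖(∫ x, (f - g) x * h (x - y i)) + ((∫ x, g x * h (x - y i)) - ∫ x, g x * c x)
        - ∫ x, (f - g) x * c x‖ := by rw [e1, e2]; congr 1; ring
    _ ≤ ‖∫ x, (f - g) x * h (x - y i)‖ + ‖(∫ x, g x * h (x - y i)) - ∫ x, g x * c x‖
        + ‖∫ x, (f - g) x * c x‖ := (norm_sub_le _ _).trans (by gcongr; exact norm_add_le _ _)
    _ < ε := by linarith

lemma integral_mul_fourier_comp_sub_smul (K φ : 𝓢(V, ℂ)) (c : ℝ) (x : V) :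
    ∫ u, 𝓕 φ (x - c • u) * K u = 𝓕 (fun ξ => (𝓕⁻ K) (c • ξ) * φ ξ) x := by
  have key : ∀ ξ u : V, (Real.fourierChar (-inner ℝ ξ (x - c • u)) • φ ξ) * K u
      = Real.fourierChar (-inner ℝ ξ x) •
        ((Real.fourierChar (inner ℝ u (c • ξ)) • K u) * φ ξ) := by
    intro ξ u
    have : -inner ℝ ξ (x - c • u) = -inner ℝ ξ x + inner ℝ u (c • ξ) := by
      rw [inner_sub_right, inner_smul_right, inner_smul_right, real_inner_comm u ξ]; ring
    rw [this, AddChar.map_add_eq_mul]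
    simp only [Circle.smul_def, Circle.coe_mul, smul_eq_mul]
    ring
  simp_rw [SchwartzMap.fourier_coe, SchwartzMap.fourierInv_coe, Real.fourier_eq,
    Real.fourierInv_eq, ← integral_mul_const, key]
  rw [integral_integral_swap]
  · congr 1 with ξ
    simp_rw [Circle.smul_def, integral_smul]
  · have hb : Integrable (fun z : V × V => K z.1 * φ z.2) (volume.prod volume) :=
      K.integrable.mul_prod φ.integrable
    refine hb.mono (Continuous.aestronglyMeasurable ?_) (.of_forall fun z => ?_)
    · simp only [Function.uncurry_def, Circle.smul_def]
      fun_prop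
    · simp [Function.uncurry_def]

/-- Moves the cutoff scale `c` into a translation of `𝓕 φ`, where its limits can be taken. -/
lemma integral_mul_fourier_cutoff [p.HolderConjugate q] {f : V → ℂ} (hf : MemLp f p)
    (K φ : 𝓢(V, ℂ)) (c : ℝ) :
    ∫ x, f x * 𝓕 (fun ξ => (𝓕⁻ K) (c • ξ) * φ ξ) x
      = ∫ u, (∫ x, f x * 𝓕 φ (x - c • u)) * K u := by
  have hI := integrable_prod_mul_comp_sub_smul hf ((𝓕 φ).memLp q) K.integrable c
  simp_rw [← integral_mul_fourier_comp_sub_smul, ← integral_const_mul, ← mul_assoc,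
    ← integral_mul_const]
  exact integral_integral_swap hI

lemma tendsto_integral_mul_fourier_cutoff [p.HolderConjugate q] (hp : p ≠ ⊤) {f : V → ℂ}
    (hf : MemLp f p) (K φ c : 𝓢(V, ℂ)) {l : Filter ℝ} [l.IsCountablyGenerated]
    (hc : ∀ᵐ u : V, ∀ x, Tendsto (fun r : ℝ => 𝓕 φ (x - r • u)) l (𝓝 (c x))) :
    Tendsto (fun r : ℝ => ∫ x, f x * 𝓕 (fun ξ => (𝓕⁻ K) (r • ξ) * φ ξ) x) l
      (𝓝 ((∫ x, f x * c x) * (𝓕⁻ K) 0)) := by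
  have h0 : (𝓕⁻ K) 0 = ∫ u, K u := by
    simp [SchwartzMap.fourierInv_coe, Real.fourierInv_eq]
  have hcont : Continuous fun y : V => ∫ x, f x * 𝓕 φ (x - y) := by
    refine continuous_iff_continuousAt.2 fun y => ?_
    have := tendsto_integral_mul_comp_sub (q := q) hp hf (𝓕 φ)
      (SchwartzMap.compSubConstCLM ℂ y (𝓕 φ)) (l := 𝓝 y) (y := id) fun x => by
        simpa using ((𝓕 φ).continuous.tendsto _).comp (tendsto_const_nhds.sub tendsto_id)
    simpa [ContinuousAt] using this
  have hφ : MemLp (𝓕 φ : 𝓢(V, ℂ)) q := (𝓕 φ).memLp q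
  simp_rw [integral_mul_fourier_cutoff (q := q) hf]
  rw [h0, ← integral_const_mul]
  refine tendsto_integral_filter_of_dominated_convergence
    (fun u => (eLpNorm f p).toReal * (eLpNorm (𝓕 φ : 𝓢(V, ℂ)) q).toReal * ‖K u‖)
    (.of_forall fun r => ?_) (.of_forall fun r => .of_forall fun u => ?_)
    (K.integrable.norm.const_mul _) ?_
  · exact ((hcont.comp (continuous_const_smul r)).mul K.continuous).aestronglyMeasurable
  · rw [norm_mul, ← eLpNorm_comp_sub hφ (r • u)]
    gcongr
    exact norm_integral_mul_le_eLpNorm_mul_eLpNorm hf (memLp_comp_sub hφ (r • u))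
  · filter_upwards [hc] with u hu
    exact (tendsto_integral_mul_comp_sub (q := q) hp hf (𝓕 φ) c hu).mul_const _

/-- An `L^p` function, `p < ∞`, whose Fourier transform vanishes off the origin is zero. -/
theorem ae_eq_zero_of_fourier_vanishes_off_origin [Nontrivial V] [p.HolderConjugate q]
    (hp : p ≠ ⊤) {f : V → ℂ} (hf : MemLp f p)
    (h : ∀ φ : 𝓢(V, ℂ), HasCompactSupport φ → tsupport φ ⊆ {0}ᶜ → ∫ x, f x * 𝓕 φ x = 0) :
    f =ᵐ[volume] 0 := by
  have hint (φ : 𝓢(V, ℂ)) : Integrable fun x => f x * 𝓕 φ x :=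
    hf.integrable_mul ((𝓕 φ).memLp q)
  let b : ContDiffBump (0 : V) := ⟨1, 2, by norm_num, by norm_num⟩
  have hχs : HasCompactSupport fun ξ => (b ξ : ℂ) :=
    b.hasCompactSupport.comp_left (g := ((↑) : ℝ → ℂ)) rfl
  have hχd : ContDiff ℝ ∞ fun ξ => (b ξ : ℂ) := Complex.ofRealCLM.contDiff.comp b.contDiff
  let χ : 𝓢(V, ℂ) := hχs.toSchwartzMap hχd
  have hχ1 (ξ : V) (hξ : ‖ξ‖ ≤ 1) : χ ξ = 1 := by
    have : b ξ = 1 := b.one_of_mem_closedBall (by simpa [b] using hξ)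
    simp [χ, this]
  have hvanish (φ : 𝓢(V, ℂ)) : ∫ x, f x * 𝓕 φ x = 0 := by
    have hsupp (r : ℝ) (hr : 0 < r) : HasCompactSupport fun ξ => χ (r • ξ) * φ ξ :=
      (HasCompactSupport.comp_homeomorph (f := χ) hχs (Homeomorph.smulOfNeZero r hr.ne')).mul_right
    have hsm (r : ℝ) : ContDiff ℝ ∞ fun ξ => χ (r • ξ) * φ ξ :=
      ((χ.smooth ⊤).comp (contDiff_const_smul r)).mul (φ.smooth ⊤)
    -- Two cutoffs of `φ` agree near `0`, so `h` applies to their difference.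
    have hconst (r : ℝ) (hr : 0 < r) : ∫ x, f x * 𝓕 (fun ξ => χ (r • ξ) * φ ξ) x
        = ∫ x, f x * 𝓕 (fun ξ => χ ((1 : ℝ) • ξ) * φ ξ) x := by
      let φ₁ := (hsupp r hr).toSchwartzMap (hsm r)
      let φ₂ := (hsupp 1 one_pos).toSchwartzMap (hsm 1)
      have := h (φ₁ - φ₂) ((hsupp r hr).sub (hsupp 1 one_pos)) ?_
      · rw [sub_eq_add_neg, FourierTransform.fourier_add, FourierTransform.fourier_neg,
          ← sub_eq_add_neg] at this
        simp only [sub_apply, mul_sub] at this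
        rw [integral_sub (hint φ₁) (hint φ₂), sub_eq_zero] at this
        exact this
      · rw [Set.subset_compl_singleton_iff, notMem_tsupport_iff_eventuallyEq]
        have hev (s : ℝ) : ∀ᶠ ξ : V in 𝓝 0, χ (s • ξ) = 1 := by
          have : Tendsto (fun ξ : V => ‖s • ξ‖) (𝓝 0) (𝓝 0) := by
            simpa using (by fun_prop : Continuous fun ξ : V => ‖s • ξ‖).tendsto 0
          filter_upwards [this.eventually_lt_const one_pos] with ξ hξ using hχ1 _ hξ.le
        filter_upwards [hev r, hev 1] with ξ h1 h2
        change χ (r • ξ) * φ ξ - χ ((1 : ℝ) • ξ) * φ ξ = 0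
        rw [h1, h2, sub_self]
    have hK : 𝓕⁻ (𝓕 χ) = χ := FourierTransform.fourierInv_fourier_eq χ
    have lim0 := tendsto_integral_mul_fourier_cutoff (q := q) hp hf (𝓕 χ) φ (𝓕 φ) (l := 𝓝[>] (0 : ℝ))
      (.of_forall fun u x => by
        have : Tendsto (fun r : ℝ => 𝓕 φ (x - r • u)) (𝓝 0) (𝓝 (𝓕 φ (x - (0 : ℝ) • u))) :=
          (by fun_prop : Continuous fun r : ℝ => 𝓕 φ (x - r • u)).tendsto 0
        simpa using this.mono_left nhdsWithin_le_nhds)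
    -- For `u ≠ 0` the point `x - r • u` escapes to infinity, where `𝓕 φ` decays.
    have limInf := tendsto_integral_mul_fourier_cutoff (q := q) hp hf (𝓕 χ) φ 0 (l := atTop) (by
      filter_upwards [Measure.ae_ne volume (0 : V)] with u hu x
      refine (𝓕 φ).tendsto_cocompact.comp ?_
      rw [← Metric.cobounded_eq_cocompact, ← comap_norm_atTop, tendsto_comap_iff]
      refine tendsto_atTop_mono (f := fun r : ℝ => r * ‖u‖ - ‖x‖) (fun r => ?_) ?_
      · have := norm_sub_norm_le (r • u) x
        rw [norm_smul, norm_sub_rev] at this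
        exact le_trans (by gcongr; exact le_abs_self r) this
      · exact tendsto_atTop_add_const_right _ _ (tendsto_id.atTop_mul_const (norm_pos_iff.2 hu)))
    rw [hK] at lim0 limInf
    rw [hχ1 0 (by simp), mul_one] at lim0
    have e0 := tendsto_nhds_unique (lim0.congr' ((eventually_mem_nhdsWithin (s := Set.Ioi (0 : ℝ))).mono
      fun r hr => hconst r hr))
      tendsto_const_nhds
    have e1 := tendsto_nhds_unique (limInf.congr' ((eventually_gt_atTop 0).mono hconst))
      tendsto_const_nhds
    rw [e0, ← e1]
    simp
  have : Fact (1 ≤ p) := ⟨ENNReal.HolderConjugate.one_le p q⟩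
  have hker : hf.toLp f ∈ (Lp.toTemperedDistributionCLM ℂ (volume : Measure V) p).ker := by
    rw [LinearMap.mem_ker]
    ext g
    have h2 : 𝓕 (𝓕⁻ g) = g := FourierTransform.fourier_fourierInv_eq g
    have h3 := hvanish (𝓕⁻ g)
    rw [h2] at h3
    change Lp.toTemperedDistribution (hf.toLp f) g = 0
    rw [Lp.toTemperedDistribution_apply, ← h3]
    refine integral_congr_ae ?_
    filter_upwards [hf.coeFn_toLp] with x hx
    rw [hx, smul_eq_mul, mul_comm]
  rw [Lp.ker_toTemperedDistributionCLM_eq_bot, Submodule.mem_bot] at hker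
  exact (MemLp.toLp_eq_toLp_iff hf MemLp.zero).1 hker

end Convolution
-- From vanishing wavelet coefficients to test functions off the origin.
section Wavelet

open Module

variable {d : ℕ} {p q : ℝ≥0∞} {f ψ ν : EuclideanSpace ℝ (Fin d) → ℂ}

local notation "𝔼" => EuclideanSpace ℝ (Fin d)

/-- The function whose Fourier transform is `u ↦ s^d conj (𝓕 g (x - s u))`. -/
lemma exists_schwartz_fourier_eq_conj {g : 𝓢(𝔼, ℂ)} (hgc : HasCompactSupport g)
    (hg0 : tsupport g ⊆ {0}ᶜ) {s : ℝ} (hs : 0 < s) (x : 𝔼) :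
    ∃ η : 𝓢(𝔼, ℂ), HasCompactSupport η ∧ tsupport η ⊆ {0}ᶜ ∧
      (∀ ξ, η ξ = Real.fourierChar (inner ℝ (s⁻¹ • ξ) x) * conj (g (s⁻¹ • ξ))) ∧
      ∀ u, 𝓕 η u = (s ^ finrank ℝ 𝔼 : ℝ) * conj (𝓕 g (x - s • u)) := by
  have hs' : s⁻¹ ≠ 0 := inv_ne_zero hs.ne'
  have hcs : HasCompactSupport fun ξ : 𝔼 =>
      (Real.fourierChar (inner ℝ (s⁻¹ • ξ) x) : ℂ) * conj (g (s⁻¹ • ξ)) :=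
    ((HasCompactSupport.comp_homeomorph (f := g) hgc
      (Homeomorph.smulOfNeZero s⁻¹ hs')).comp_left (g := conj) (map_zero _)).mul_left
  have hsm : ContDiff ℝ ∞ fun ξ : 𝔼 =>
      (Real.fourierChar (inner ℝ (s⁻¹ • ξ) x) : ℂ) * conj (g (s⁻¹ • ξ)) := by
    refine ContDiff.mul ?_ (Complex.conjCLE.contDiff.comp
      ((g.smooth ⊤).comp (contDiff_const_smul s⁻¹)))
    simp_rw [Real.fourierChar_apply]
    exact Complex.contDiff_exp.comp ((Complex.ofRealCLM.contDiff.comp (contDiff_const.mul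
      ((contDiff_const_smul s⁻¹).inner ℝ contDiff_const))).mul contDiff_const)
  refine ⟨hcs.toSchwartzMap hsm, hcs, ?_, fun ξ => rfl, fun u => ?_⟩
  · rw [Set.subset_compl_singleton_iff, notMem_tsupport_iff_eventuallyEq] at hg0 ⊢
    have : Filter.Tendsto (fun ξ : 𝔼 => s⁻¹ • ξ) (nhds 0) (nhds 0) := by
      simpa using (continuous_const_smul s⁻¹).tendsto (0 : 𝔼)
    filter_upwards [this.eventually hg0] with ξ hξ
    simp [hξ]
  · rw [SchwartzMap.fourier_coe, SchwartzMap.fourier_coe, Real.fourier_eq, Real.fourier_eq,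
      ← integral_conj]
    have key (ξ : 𝔼) : Real.fourierChar (-inner ℝ ξ u) • hcs.toSchwartzMap hsm ξ
        = conj (Real.fourierChar (-inner ℝ (s⁻¹ • ξ) (x - s • u)) • g (s⁻¹ • ξ)) := by
      have h1 : inner ℝ ξ u = inner ℝ (s⁻¹ • ξ) (s • u) := by
        rw [inner_smul_left, inner_smul_right]
        simp [hs.ne']
      change _ • ((Real.fourierChar (inner ℝ (s⁻¹ • ξ) x) : ℂ) * conj (g (s⁻¹ • ξ))) = _
      rw [Circle.smul_def, Circle.smul_def, smul_eq_mul, smul_eq_mul, map_mul,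
        ← Circle.coe_inv_eq_conj, ← AddChar.map_neg_eq_inv, neg_neg, inner_sub_right, h1,
        sub_eq_neg_add, AddChar.map_add_eq_mul, Circle.coe_mul, mul_assoc]
    simp_rw [key]
    rw [Measure.integral_comp_inv_smul_of_nonneg volume
      (fun ξ => conj (Real.fourierChar (-inner ℝ ξ (x - s • u)) • g ξ)) hs.le, Complex.real_smul]

/-- The convolution theorem for a dilated `L^q` function and a Schwartz function whose Fourier
transform has compact support off the origin. -/
lemma integral_conj_comp_mul_fourier [Fact (1 ≤ q)] (hψ : MemLp ψ q)
    (hν : RepresentsOffOrigin (𝓕 ((hψ.toLp ψ : Lp ℂ q (volume : Measure 𝔼)) : 𝓢'(𝔼, ℂ))) ν)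
    {g m : 𝓢(𝔼, ℂ)} (hgc : HasCompactSupport g) (hg0 : tsupport g ⊆ {0}ᶜ) {s : ℝ} (hs : 0 < s)
    (hm : ∀ ξ, m ξ = conj (ν (s • ξ)) * g ξ) (x : 𝔼) :
    ∫ t, conj (ψ (s⁻¹ • (x - t))) * 𝓕 g t = (s ^ finrank ℝ 𝔼 : ℝ) * 𝓕 m x := by
  obtain ⟨η, hηc, hη0, hη, hFη⟩ := exists_schwartz_fourier_eq_conj hgc hg0 hs x
  have hsd : ((s ^ finrank ℝ 𝔼 : ℝ) : ℂ) ≠ 0 := by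
    exact_mod_cast (pow_pos hs _).ne'
  have h1 : ∫ u, ψ u * conj (𝓕 g (x - s • u)) = conj (𝓕 m x) := by
    -- Both sides acquire a factor `s ^ d`: the left from `𝓕 η`, the right from the change of
    -- variables.
    have h := hν η hηc hη0
    rw [TemperedDistribution.fourier_apply, Lp.toTemperedDistribution_apply] at h
    have hL : ∫ u, 𝓕 η u • (hψ.toLp ψ) u
        = (s ^ finrank ℝ 𝔼 : ℝ) * ∫ u, ψ u * conj (𝓕 g (x - s • u)) := by
      rw [← integral_const_mul]
      refine integral_congr_ae ?_
      filter_upwards [hψ.coeFn_toLp] with u hu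
      rw [hu, hFη, smul_eq_mul]
      ring
    have hR : ∫ y, ν y * η y = (s ^ finrank ℝ 𝔼 : ℝ) * conj (𝓕 m x) := by
      rw [SchwartzMap.fourier_coe, Real.fourier_eq, ← integral_conj, ← Complex.real_smul,
        ← Measure.integral_comp_inv_smul_of_nonneg volume _ hs.le]
      congr 1 with ξ
      rw [hη, hm, Circle.smul_def, smul_eq_mul, smul_inv_smul₀ hs.ne', map_mul, map_mul,
        Complex.conj_conj, ← Circle.coe_inv_eq_conj, ← AddChar.map_neg_eq_inv, neg_neg]
      ring
    rw [hL, hR] at h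
    exact mul_left_cancel₀ hsd h
  have h2 : ∫ u, conj (ψ u) * 𝓕 g (x - s • u) = 𝓕 m x := by
    rw [← Complex.conj_conj (𝓕 m x), ← h1, ← integral_conj]
    simp
  rw [← h2, ← Complex.real_smul, ← Measure.integral_comp_inv_smul_of_nonneg volume _ hs.le,
    ← integral_sub_left_eq_self _ volume x]
  simp [smul_inv_smul₀ hs.ne']

/-- Fubini for `f x * conj (ψ (s⁻¹ • (x - t))) * 𝓕 g t`: the `x`-integral is a wavelet coefficient
up to normalisation, the `t`-integral is the convolution theorem. -/
lemma integral_mul_fourier_eq_zero_of_waveletTransform [Fact (1 ≤ q)] [p.HolderConjugate q]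
    (hf : MemLp f p) (hψ : MemLp ψ q)
    (hν : RepresentsOffOrigin (𝓕 ((hψ.toLp ψ : Lp ℂ q (volume : Measure 𝔼)) : 𝓢'(𝔼, ℂ))) ν)
    {g m : 𝓢(𝔼, ℂ)} (hgc : HasCompactSupport g) (hg0 : tsupport g ⊆ {0}ᶜ) {s : ℝ} (hs : 0 < s)
    (hm : ∀ ξ, m ξ = conj (ν (s • ξ)) * g ξ) (hW : ∀ t, waveletTransform ψ f s t = 0) :
    ∫ x, f x * 𝓕 m x = 0 := by
  have hW' (t : 𝔼) : ∫ x, f x * conj (ψ (s⁻¹ • (x - t))) = 0 := by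
    have h := hW t
    have hc : ((1 / s ^ ((d : ℝ) / 2) : ℝ) : ℂ) ≠ 0 := by
      exact_mod_cast (one_div_pos.2 (Real.rpow_pos_of_pos hs _)).ne'
    simp_rw [waveletTransform, dilatedWavelet, map_mul, Complex.conj_ofReal,
      mul_left_comm (f _)] at h
    rw [integral_const_mul] at h
    exact (mul_eq_zero.1 h).resolve_left hc
  have hk : MemLp (fun x : 𝔼 => conj (ψ (s⁻¹ • x))) q :=
    (memLp_comp_smul hψ (inv_ne_zero hs.ne')).star
  have hI := integrable_prod_mul_comp_sub_smul hf hk (𝓕 g).integrable 1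
  simp only [one_smul] at hI
  have hswap := integral_integral_swap
    (f := fun x t => f x * conj (ψ (s⁻¹ • (x - t))) * 𝓕 g t) hI
  simp_rw [integral_mul_const, hW', zero_mul, integral_zero, mul_assoc, integral_const_mul,
    integral_conj_comp_mul_fourier hψ hν hgc hg0 hs hm, mul_left_comm (f _)] at hswap
  rw [integral_const_mul] at hswap
  exact (mul_eq_zero.1 hswap).resolve_left (by exact_mod_cast (pow_pos hs _).ne')

/-- Compactly supported smooth functions off the origin are finite sums of multiples of the dilates
of `conj ν` when `ν` has no zero ray. -/
lemma exists_finset_sum_conj_dilate_mul (hν : ContDiffOn ℝ ∞ ν {0}ᶜ)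
    (hne : ∀ ξ : 𝔼, ξ ≠ 0 → ∃ s : ℝ, 0 < s ∧ ν (s • ξ) ≠ 0)
    {φ : 𝓢(𝔼, ℂ)} (hφc : HasCompactSupport φ) (hφ0 : tsupport φ ⊆ {0}ᶜ) :
    ∃ (S : Finset {s : ℝ // 0 < s}) (g m : {s : ℝ // 0 < s} → 𝓢(𝔼, ℂ)),
      (∀ s, HasCompactSupport (g s) ∧ tsupport (g s) ⊆ {0}ᶜ ∧
        ∀ ξ, m s ξ = conj (ν (s.1 • ξ)) * g s ξ) ∧ φ = ∑ s ∈ S, m s := by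
  have hνs (s : {s : ℝ // 0 < s}) : ContDiffOn ℝ ∞ (fun ξ : 𝔼 => ν (s.1 • ξ)) {0}ᶜ :=
    hν.comp (contDiff_const_smul s.1).contDiffOn fun ξ hξ => smul_ne_zero s.2.ne' hξ
  have hνc (s : {s : ℝ // 0 < s}) : ContDiffOn ℝ ∞ (fun ξ : 𝔼 => conj (ν (s.1 • ξ))) {0}ᶜ :=
    Complex.conjCLE.contDiff.comp_contDiffOn (hνs s)
  obtain ⟨S, hS⟩ := IsCompact.elim_finite_subcover (s := tsupport φ) hφc
    (fun s : {s : ℝ // 0 < s} => {0}ᶜ ∩ (fun ξ : 𝔼 => ν (s.1 • ξ)) ⁻¹' {0}ᶜ)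
    (fun s => (hνs s).continuousOn.isOpen_inter_preimage isOpen_compl_singleton
      isOpen_compl_singleton)
    (fun ξ hξ => by
      obtain ⟨s, hs, h⟩ := hne ξ (hφ0 hξ)
      exact Set.mem_iUnion.2 ⟨⟨s, hs⟩, hφ0 hξ, h⟩)
  -- `D = ∑ |ν (s • ξ)|²` is positive on `tsupport φ`, so `g s = ν (s • ξ) / D * φ` gives `∑ m s =
  -- φ`.
  let D : 𝔼 → ℂ := fun ξ => ∑ s ∈ S, ν (s.1 • ξ) * conj (ν (s.1 • ξ))
  have hDs : ContDiffOn ℝ ∞ D {0}ᶜ := ContDiffOn.sum fun s _ => (hνs s).mul (hνc s)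
  have hD (ξ : 𝔼) (hξ : ξ ∈ tsupport φ) : D ξ ≠ 0 := by
    obtain ⟨s, hs, -, h⟩ := Set.mem_iUnion₂.1 (hS hξ)
    have hD' : D ξ = ((∑ s ∈ S, ‖ν (s.1 • ξ)‖ ^ 2 : ℝ) : ℂ) := by
      simp [D, Complex.mul_conj']
    rw [hD']
    exact_mod_cast (Finset.sum_pos' (fun _ _ => by positivity)
      ⟨s, hs, pow_pos (norm_pos_iff.2 h) 2⟩).ne'
  -- Zeros of `D` away from `tsupport φ` are harmless, since `φ` vanishes there.
  have hmul {a : 𝔼 → ℂ} (ha : ∀ ξ ∈ tsupport φ, ContDiffAt ℝ ∞ a ξ) :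
      ContDiff ℝ ∞ fun ξ => a ξ * φ ξ :=
    (contMDiff_of_tsupport fun ξ hξ =>
      ((ha ξ (closure_mono (Function.support_mul_subset_right _ _) hξ)).mul
        (φ.smooth ⊤).contDiffAt).contMDiffAt).contDiff
  have hcs (a : 𝔼 → ℂ) : HasCompactSupport fun ξ => a ξ * φ ξ := HasCompactSupport.mul_left hφc
  have hnhds {ξ : 𝔼} (hξ : ξ ∈ tsupport φ) : ({0}ᶜ : Set 𝔼) ∈ nhds ξ :=
    isOpen_compl_singleton.mem_nhds (hφ0 hξ)
  have hdiv (s : {s : ℝ // 0 < s}) (ξ : 𝔼) (hξ : ξ ∈ tsupport φ) :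
      ContDiffAt ℝ ∞ (fun ξ => ν (s.1 • ξ) / D ξ) ξ := by
    simp_rw [div_eq_mul_inv]
    exact ((hνs s).contDiffAt (hnhds hξ)).mul ((hDs.contDiffAt (hnhds hξ)).inv (hD ξ hξ))
  have hg (s : {s : ℝ // 0 < s}) : ContDiff ℝ ∞ fun ξ => ν (s.1 • ξ) / D ξ * φ ξ :=
    hmul fun ξ hξ => hdiv s ξ hξ
  have hm (s : {s : ℝ // 0 < s}) :
      ContDiff ℝ ∞ fun ξ => conj (ν (s.1 • ξ)) * (ν (s.1 • ξ) / D ξ) * φ ξ :=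
    hmul fun ξ hξ => ((hνc s).contDiffAt (hnhds hξ)).mul
      (hdiv s ξ hξ)
  refine ⟨S, fun s => (hcs _).toSchwartzMap (hg s), fun s => (hcs _).toSchwartzMap (hm s),
    fun s => ⟨hcs _, ?_, fun ξ => mul_assoc _ _ _⟩, ?_⟩
  · exact (closure_mono (Function.support_mul_subset_right _ _)).trans hφ0
  · ext ξ
    rw [sum_apply]
    change φ ξ = ∑ s ∈ S, conj (ν (s.1 • ξ)) * (ν (s.1 • ξ) / D ξ) * φ ξ
    by_cases hξ : ξ ∈ tsupport φ
    · have : ∑ s ∈ S, conj (ν (s.1 • ξ)) * (ν (s.1 • ξ) / D ξ) = 1 := by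
        rw [← div_self (hD ξ hξ)]
        simp_rw [← mul_div_assoc, ← Finset.sum_div]
        congr 1
        exact Finset.sum_congr rfl fun s _ => mul_comm _ _
      rw [← Finset.sum_mul, this, one_mul]
    · simp [image_eq_zero_of_notMem_tsupport hξ]

lemma exists_dilate_ne_zero (h : ∀ ξ : 𝔼, ‖ξ‖ = 1 → NontrivialInDirection ν ξ) (ξ : 𝔼)
    (hξ : ξ ≠ 0) : ∃ s : ℝ, 0 < s ∧ ν (s • ξ) ≠ 0 := by
  have hn : ‖‖ξ‖⁻¹ • ξ‖ = 1 := by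
    rw [norm_smul, norm_inv, norm_norm, inv_mul_cancel₀ (norm_ne_zero_iff.2 hξ)]
  obtain ⟨r, hr, hne⟩ := nonempty_of_measure_ne_zero (h _ hn).ne'
  exact ⟨r * ‖ξ‖⁻¹, by have := norm_pos_iff.2 hξ; positivity, by rwa [mul_smul]⟩

end Wavelet

theorem theorem2 (d : ℕ) (hd : 1 ≤ d) (p p' : ℝ≥0∞) (hp : 1 ≤ p) (hp_top : p < ⊤)
    [Fact (1 ≤ p')] (hpp' : 1 / p + 1 / p' = 1)
    (f ψ : EuclideanSpace ℝ (Fin d) → ℂ)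
    (hf : MemLp f p volume) (hψ : MemLp ψ p' volume)
    (ν : EuclideanSpace ℝ (Fin d) → ℂ)
    (hν_smooth : ContDiffOn ℝ ∞ ν {0}ᶜ)
    (hν : RepresentsOffOrigin
      (𝓕 ((hψ.toLp ψ : Lp ℂ p' (volume : Measure (EuclideanSpace ℝ (Fin d)))) :
        𝓢'(EuclideanSpace ℝ (Fin d), ℂ))) ν)
    (hν_nontrivial : ∀ ξ : EuclideanSpace ℝ (Fin d), ‖ξ‖ = 1 → NontrivialInDirection ν ξ)
    (hW : ∀ s : ℝ, 0 < s → ∀ t : EuclideanSpace ℝ (Fin d), waveletTransform ψ f s t = 0) :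
    f =ᵐ[volume] 0 := by
  have : p.HolderConjugate p' := ⟨by simpa using hpp'⟩
  -- Makes the space nontrivial, so that almost every `u` is nonzero.
  have : NeZero d := ⟨by omega⟩
  refine ae_eq_zero_of_fourier_vanishes_off_origin (q := p') hp_top.ne hf fun φ hφc hφ0 => ?_
  obtain ⟨S, g, m, hgm, rfl⟩ := exists_finset_sum_conj_dilate_mul hν_smooth
    (exists_dilate_ne_zero hν_nontrivial) hφc hφ0
  rw [FourierTransform.fourier_sum]
  simp_rw [sum_apply, Finset.mul_sum]
  have hint (s) : Integrable fun x => f x * 𝓕 (m s) x :=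
    hf.integrable_mul ((𝓕 (m s)).memLp p')
  rw [integral_finsetSum _ fun s _ => hint s]
  exact Finset.sum_eq_zero fun s _ => integral_mul_fourier_eq_zero_of_waveletTransform hf hψ hν
    (hgm s).1 (hgm s).2.1 s.2 (hgm s).2.2 (hW s.1 s.2)
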